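/- Let $N\in\mathbb{N}$, $\Theta_{2N}=\{1,\dots,2N\}$, and let $J=(J_{ij})_{i,j\in\Theta_{2N}}$ be a real matrix satisfying condition (i) with a constant $\varkappa>0$: $J_{ii}=0$ and $J_{ij}=J_{ji}\ge 0$ for all $i,j$, and there is a division $\Theta_{2N}=\bigcup_{k=1}^N\vartheta_k$ into disjoint two-element subsets $\vartheta_k=\{i_k,j_k\}$ with $J_{i_kj_k}\ge\varkappa$ for all $k$. For an inverse temperature $\beta>0$ and a thinning probability $q\in[0,1)$, the annealed partition function of the site-diluted $s=\pm1$ Ising model in the external field $h\in\mathbb{C}$ is $$Z_{2N}(h)=2^{2N}\left[\exp\Big(\tfrac12\sum_{i,j\in\Theta_{2N}}\beta J_{ij}\frac{\partial^2}{\partial x_i\partial x_j}\Big)\Big\langle\prod_{i\in\Theta_{2N}}\phi_i(x_i)\Big\rangle\right]_{\text{all }x_i=\beta h},$$ where the exponential is defined by its (convergent) power series, and $\langle\cdot\rangle$ is the average over the independent random deletion of each site with probability $q$, with $\phi_i(x)=\cosh x$ if the site $i$ is kept and $\phi_i(x)=1$ if it is deleted (so that $\langle\prod_i\phi_i(x_i)\rangle=\prod_i((1-q)\cosh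 x_i+q)$). If $$\frac{q}{1-q}\le\sqrt{\frac{e^{\beta\varkappa}+e^{-\beta\varkappa}}{2}}=\sqrt{\cosh(\beta\varkappa)},$$ then all zeros $h\in\mathbb{C}$ of $Z_{2N}$ are purely imaginary (and nonzero). Consequently, for all $\varkappa>0$ and $q\in[0,1)$ there is $\beta_0>0$ (depending only on $\varkappa$ and $q$) such that for every $\beta\ge\beta_0$, every $N$ and every $J$ satisfying condition (i) with constant $\varkappa$, all zeros of $Z_{2N}$ are purely imaginary. -/

import Mathlib

/-- The partial derivative `D i f = ∂f/∂x_i` of a function of the complex variables `(x_i)`. -/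
noncomputable def partialD {ι : Type*} [DecidableEq ι] (i : ι) (f : (ι → ℂ) → ℂ) :
    (ι → ℂ) → ℂ :=
  fun x => lineDeriv ℂ f x (Pi.single i 1)

/-- The second order operator `(1/2) ∑_{i,j} K_{ij} D_i D_j`. -/
noncomputable def quadOp {ι : Type*} [Fintype ι] [DecidableEq ι] (K : Matrix ι ι ℝ)
    (f : (ι → ℂ) → ℂ) : (ι → ℂ) → ℂ :=
  fun x => (1 / 2 : ℂ) * ∑ i, ∑ j, (K i j : ℂ) * partialD i (partialD j f) x

/-- The `n`-th term, at the point `x`, of the power series of `exp((1/2) ∑_{i,j} K_{ij} D_i D_j) f`. -/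
noncomputable def expQuadTerm {ι : Type*} [Fintype ι] [DecidableEq ι] (K : Matrix ι ι ℝ)
    (f : (ι → ℂ) → ℂ) (x : ι → ℂ) (n : ℕ) : ℂ :=
  ((n.factorial : ℂ))⁻¹ * ((quadOp K)^[n] f) x

/-- The infinite order operator `exp((1/2) ∑_{i,j} K_{ij} D_i D_j)`, given by its power series. -/
noncomputable def expQuadOp {ι : Type*} [Fintype ι] [DecidableEq ι] (K : Matrix ι ι ℝ)
    (f : (ι → ℂ) → ℂ) : (ι → ℂ) → ℂ :=
  fun x => ∑' n : ℕ, expQuadTerm K f x n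

/-- Probability of the configuration `η` under independent thinning: every site is deleted
(`η i = false`) with probability `q` and kept (`η i = true`) with probability `1 - q`. -/
noncomputable def thinningWeight {ι : Type*} [Fintype ι] (q : ℝ) (η : ι → Bool) : ℝ :=
  ∏ i, if η i then 1 - q else q

/-- Averaging `⟨X⟩` over the thinning. -/
noncomputable def thinningAverage {ι : Type*} [Fintype ι] [DecidableEq ι] (q : ℝ)
    (X : (ι → Bool) → ℂ) : ℂ :=
  ∑ η : ι → Bool, (thinningWeight q η : ℂ) * X η

/-- The random normalized single-spin partition function of an `s = ±1` spin subject to thinning: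
`cosh x` if the site is kept, `1` if it is deleted. -/
noncomputable def siteFunction (kept : Bool) (x : ℂ) : ℂ :=
  if kept then Complex.cosh x else 1

/-- `⟨∏ i, φ(x_i)⟩` -/
noncomputable def averagedProduct {ι : Type*} [Fintype ι] [DecidableEq ι] (q : ℝ) :
    (ι → ℂ) → ℂ :=
  fun x => thinningAverage q fun η => ∏ i, siteFunction (η i) (x i)

/-- The exponential sum `∑_a w_a exp(∑_i c_{a,i} x_i)`. -/
noncomputable def expSum {ι : Type*} [Fintype ι] {A : Type*} [Fintype A] (w : A → ℂ) (c : A → ι → ℂ) : (ι → ℂ) → ℂ :=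
  fun x => ∑ a, w a * Complex.exp (∑ i, c a i * x i)

theorem partialD_expSum {ι : Type*} [Fintype ι] [DecidableEq ι] {A : Type*} [Fintype A] (w : A → ℂ) (c : A → ι → ℂ) (i : ι) :
    partialD i (expSum w c) = expSum (fun a => w a * c a i) c := by
  funext x
  unfold partialD expSum
  refine HasDerivAt.deriv (𝕜 := ℂ) ?_
  refine HasDerivAt.fun_sum fun a _ => ?_
  have h1 : HasDerivAt (fun t : ℂ => ∑ k, c a k * (x + t • (Pi.single i 1 : ι → ℂ)) k) (c a i) 0 := by
    have : (fun t : ℂ => ∑ k, c a k * (x + t • (Pi.single i 1 : ι → ℂ)) k)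
        = fun t => (∑ k, c a k * x k) + c a i * t := by
      funext t
      simp [mul_add, Finset.sum_add_distrib, Pi.single_apply]
    rw [this]
    simpa using ((hasDerivAt_id (0:ℂ)).const_mul (c a i)).const_add (∑ k, c a k * x k)
  have := (h1.cexp).const_mul (w a)
  simp only [zero_smul, add_zero] at this
  have e : w a * c a i * Complex.exp (∑ k, c a k * x k) = w a * (Complex.exp (∑ k, c a k * x k) * c a i) := by ring
  rw [e]; exact this

/-- The value `(1/2) ∑_{i,j} K_{ij} v_i v_j`. -/
noncomputable def halfQuadForm {ι : Type*} [Fintype ι] (K : Matrix ι ι ℝ) (v : ι → ℂ) : ℂ :=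
  (1/2) * ∑ i, ∑ j, (K i j : ℂ) * v i * v j

theorem quadOp_expSum {ι : Type*} [Fintype ι] [DecidableEq ι] {A : Type*} [Fintype A] (K : Matrix ι ι ℝ) (w : A → ℂ) (c : A → ι → ℂ) :
    quadOp K (expSum w c) = expSum (fun a => halfQuadForm K (c a) * w a) c := by
  funext x
  unfold quadOp
  simp only [partialD_expSum]
  unfold expSum halfQuadForm
  simp only [Finset.mul_sum, Finset.sum_mul]
  have e : ∀ i : ι, (∑ j, ∑ a, (1 / 2 : ℂ) * ((K i j:ℂ) * (w a * c a j * c a i * Complex.exp (∑ k, c a k * x k)))) = ∑ a, ∑ j, (1 / 2 : ℂ) * ((K i j:ℂ) * (w a * c a j * c a i * Complex.exp (∑ k, c a k * x k))) := fun i => Finset.sum_comm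
  simp only [e]
  rw [Finset.sum_comm]
  refine Finset.sum_congr rfl fun a _ => Finset.sum_congr rfl fun i _ => Finset.sum_congr rfl fun j _ => ?_
  ring

theorem quadOp_iterate_expSum {ι : Type*} [Fintype ι] [DecidableEq ι] {A : Type*} [Fintype A] (K : Matrix ι ι ℝ) (w : A → ℂ) (c : A → ι → ℂ) (n : ℕ) :
    (quadOp K)^[n] (expSum w c) = expSum (fun a => halfQuadForm K (c a) ^ n * w a) c := by
  induction n with
  | zero => simp
  | succ n ih =>
    rw [Function.iterate_succ_apply', ih, quadOp_expSum]
    congr 1; funext a; ring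

theorem hasSum_expSum {ι : Type*} [Fintype ι] [DecidableEq ι] {A : Type*} [Fintype A] (K : Matrix ι ι ℝ) (w : A → ℂ) (c : A → ι → ℂ) (x : ι → ℂ) :
    HasSum (expQuadTerm K (expSum w c) x)
      (∑ a, w a * Complex.exp (halfQuadForm K (c a)) * Complex.exp (∑ i, c a i * x i)) := by
  unfold expQuadTerm
  simp only [quadOp_iterate_expSum]
  unfold expSum
  simp only [Finset.mul_sum]
  refine hasSum_sum fun a _ => ?_
  have h := (NormedSpace.expSeries_div_hasSum_exp (halfQuadForm K (c a)))
  rw [← Complex.exp_eq_exp_ℂ] at h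
  have h2 := ((h.mul_left (w a)).mul_right (Complex.exp (∑ i, c a i * x i)))
  refine Eq.mp (congrArg (fun f => HasSum f _) (funext fun n => ?_)) h2
  rw [div_eq_mul_inv]; ring

theorem averagedProduct_eq {ι : Type*} [Fintype ι] [DecidableEq ι] (q : ℝ) :
    (averagedProduct q : (ι → ℂ) → ℂ) = expSum (A := (ι → Bool) × (ι → Bool))
      (fun a => (thinningWeight q a.1 : ℂ) * (1/2) ^ Fintype.card ι)
      (fun a i => if a.1 i then (if a.2 i then 1 else -1) else 0) := by
  funext x
  unfold averagedProduct thinningAverage expSum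
  rw [Fintype.sum_prod_type]
  refine Finset.sum_congr rfl fun η _ => ?_
  simp only [mul_assoc, ← Finset.mul_sum]
  congr 1
  simp only [Complex.exp_sum]
  have : ∀ i, siteFunction (η i) (x i) = ∑ b : Bool, (1/2) * Complex.exp ((if η i then (if b then 1 else -1) else 0) * x i) := by
    intro i
    cases h : η i
    · simp [siteFunction]
    · simp [siteFunction, Complex.cosh]; ring
  simp only [this, Finset.prod_univ_sum, Fintype.piFinset_univ, Finset.prod_mul_distrib, ← Finset.mul_sum]
  simp [Finset.prod_const]

/-- The power series defining the annealed partition function converges at every point. -/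
theorem summable_expQuadTerm {ι : Type*} [Fintype ι] [DecidableEq ι] (K : Matrix ι ι ℝ) (q : ℝ)
    (x : ι → ℂ) : Summable (expQuadTerm K (averagedProduct q) x) := by
  rw [averagedProduct_eq]
  exact (hasSum_expSum K _ _ x).summable

/-- The annealed partition function `Z(h)` of the site-diluted `s = ±1` Ising model on the finite
set `ι` of sites, with interaction matrix `J`, inverse temperature `β`, thinning probability `q`
and (complex) external field `h`. -/
noncomputable def annealedZ {ι : Type*} [Fintype ι] [DecidableEq ι] (J : Matrix ι ι ℝ)
    (β q : ℝ) (h : ℂ) : ℂ :=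
  2 ^ Fintype.card ι * expQuadOp (β • J) (averagedProduct q) (fun _ => (β : ℂ) * h)

/-- Condition (i) with constant `ϰ`: the matrix has zero diagonal, is symmetric and has nonnegative
entries, and the `2N` indices can be divided into `N` disjoint two-element sets `{i, j}`
with `ϰ ≤ K i j`, where `ϰ > 0`. -/
structure ConditionI {N : ℕ} (K : Matrix (Fin (2 * N)) (Fin (2 * N)) ℝ) (ϰ : ℝ) : Prop where
  diag : ∀ i, K i i = 0
  symm : ∀ i j, K i j = K j i
  nonneg : ∀ i j, 0 ≤ K i j
  pos : 0 < ϰ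
  division : ∃ ϑ : Fin N → Finset (Fin (2 * N)),
    (∀ k l, k ≠ l → Disjoint (ϑ k) (ϑ l)) ∧
    (∀ i, ∃ k, i ∈ ϑ k) ∧
    ∀ k, ∃ i j, i ≠ j ∧ ϑ k = {i, j} ∧ ϰ ≤ K i j

/-- All complex zeros of `Z` are purely imaginary (in particular different from `0`). -/
def HasPurelyImaginaryZeros (Z : ℂ → ℂ) : Prop :=
  ∀ h : ℂ, Z h = 0 → h.re = 0 ∧ h.im ≠ 0

/-! Up to a nonvanishing factor, the partition function is a polynomial in which a site of spin `σ ∈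
{-1, 0, 1}` (zero when deleted) contributes `z ^ (σ + 1)`, evaluated at `z = exp (β h)` for all
sites. It is even in `h` and nonzero at `h = 0`, so it suffices to exclude zeros with `re h < 0`,
and for this the multivariate polynomial should have no zeros in the open unit polydisc.

A single diluted site can violate this when `q > 1/2`, so the starting point is the pairs. With
coupling exactly `β ϰ` inside each pair and none elsewhere, the polynomial factors over pairs. Each
factor is zero-free by Schur–Cohn when `(q / (1 - q)) ^ 2 ≤ cosh (β ϰ)` (`pair_polynomial_ne_zero`).
The remaining couplings are nonnegative, and adding such a coupling preserves zero-freeness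
(`biquadratic_coupling`): Grace–Walsh–Szegő splits each three-valued spin into two two-valued ones,
and the coupling becomes four dampings of mixed bilinear coefficients, harmless by
`bilinear_ne_zero`. -/

/-! ### Damping bilinear polynomials in the bidisc -/

-- Solving for `w`, zero-freeness for fixed `z` amounts to `|C + D z| ≤ |A + B z|` with `A + B z ≠
-- 0`. The damped inequality interpolates between `t = 0` and `t = 1`, with an error term whose sign
-- is controlled by `‖B‖ ≤ ‖C‖`.
open Complex in
theorem bilinear_ne_zero_of_norm_le {A B C D : ℂ} (hBC : ‖B‖ ≤ ‖C‖)
    (H : ∀ z w : ℂ, ‖z‖ < 1 → ‖w‖ < 1 → A + B * z + C * w + D * (z * w) ≠ 0)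
    {t : ℝ} (ht0 : 0 ≤ t) (ht1 : t ≤ 1) {z w : ℂ} (hz : ‖z‖ < 1) (hw : ‖w‖ < 1) :
    A + t * B * z + t * C * w + D * (z * w) ≠ 0 := by
  have dom : ∀ A B C D : ℂ,
      (∀ z w : ℂ, ‖z‖ < 1 → ‖w‖ < 1 → A + B * z + C * w + D * (z * w) ≠ 0) →
      ∀ z : ℂ, ‖z‖ < 1 → normSq (C + D * z) ≤ normSq (A + B * z) := by
    intro A B C D H z hz
    by_contra! hlt
    have hlt' : ‖A + B * z‖ < ‖C + D * z‖ := by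
      rw [normSq_eq_norm_sq, normSq_eq_norm_sq] at hlt
      exact lt_of_pow_lt_pow_left₀ 2 (norm_nonneg _) hlt
    have hpos : 0 < ‖C + D * z‖ := (norm_nonneg _).trans_lt hlt'
    have hne : C + D * z ≠ 0 := norm_pos_iff.1 hpos
    refine H z (-(A + B * z) / (C + D * z)) hz ?_ ?_
    · rw [norm_div, norm_neg, div_lt_one hpos]; exact hlt'
    · have := div_mul_cancel₀ (-(A + B * z)) hne
      linear_combination this
  have H' : ∀ z w : ℂ, ‖z‖ < 1 → ‖w‖ < 1 → A + C * z + B * w + D * (z * w) ≠ 0 := by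
    intro z w hz hw h
    exact H w z hw hz (by linear_combination h)
  have hzsq : normSq z < 1 := by
    rw [normSq_eq_norm_sq]; exact pow_lt_one₀ (norm_nonneg _) hz (by norm_num)
  have hBC' : normSq B ≤ normSq C := by
    rw [normSq_eq_norm_sq, normSq_eq_norm_sq]; gcongr
  have hz' : ‖-z‖ < 1 := by rwa [norm_neg]
  have e1 := dom A B C D H z hz
  have e2 := dom A B C D H (-z) hz'
  have e3 := dom A C B D H' z hz
  have e4 := dom A C B D H' (-z) hz'
  have key : normSq (t * C + D * z) ≤ normSq (A + t * B * z) := by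
    -- Averaging over `±z` removes the cross terms; adding the version with `B` and `C` exchanged
    -- gives `2 (|A|² - |D|²|z|²) ≥ (1 - |z|²)(|B|² + |C|²)`.
    have s0 : normSq D * normSq z ≤ normSq A := by
      rw [← mul_neg_one z] at e2 e4
      have hB := mul_nonneg (sub_nonneg.2 hzsq.le) (normSq_nonneg B)
      have hC := mul_nonneg (sub_nonneg.2 hzsq.le) (normSq_nonneg C)
      simp only [normSq_apply, mul_re, mul_im, add_re, add_im, neg_re, neg_im, one_re, one_im]
        at *
      nlinarith
    have s1 : normSq B * normSq z ≤ normSq C := by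
      nlinarith [normSq_nonneg B, normSq_nonneg z]
    have id : normSq (A + t * B * z) - normSq (t * C + D * z)
        = (1 - t) * (normSq A - normSq D * normSq z)
          + t * (normSq (A + B * z) - normSq (C + D * z))
          + t * (1 - t) * (normSq C - normSq B * normSq z) := by
      simp only [normSq_apply, mul_re, mul_im, add_re, add_im, ofReal_re, ofReal_im]
      ring
    have h1 := mul_nonneg (sub_nonneg.2 ht1) (sub_nonneg.2 s0)
    have h2 := mul_nonneg ht0 (sub_nonneg.2 e1)
    have h3 := mul_nonneg (mul_nonneg ht0 (sub_nonneg.2 ht1)) (sub_nonneg.2 s1)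
    linarith
  have key' : ‖t * C + D * z‖ ≤ ‖A + t * B * z‖ := by
    rw [normSq_eq_norm_sq, normSq_eq_norm_sq] at key
    exact (sq_le_sq₀ (norm_nonneg _) (norm_nonneg _)).1 key
  have hne : A + t * B * z ≠ 0 := by
    intro h
    refine H (t * z) 0 ?_ (by simp) (by linear_combination h)
    rw [norm_mul, norm_real, Real.norm_of_nonneg ht0]
    nlinarith [norm_nonneg z]
  intro h
  have h2 : A + t * B * z = -(w * (t * C + D * z)) := by linear_combination h
  have h3 : ‖A + t * B * z‖ = ‖w‖ * ‖t * C + D * z‖ := by rw [h2, norm_neg, norm_mul]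
  have h4 : 0 < ‖A + t * B * z‖ := norm_pos_iff.2 hne
  nlinarith [norm_nonneg w]

/-- Damping the two mixed coefficients of a bilinear polynomial preserves the absence of zeros in
the open unit bidisc. -/
theorem bilinear_ne_zero {A B C D : ℂ}
    (H : ∀ z w : ℂ, ‖z‖ < 1 → ‖w‖ < 1 → A + B * z + C * w + D * (z * w) ≠ 0)
    {t : ℝ} (ht0 : 0 ≤ t) (ht1 : t ≤ 1) {z w : ℂ} (hz : ‖z‖ < 1) (hw : ‖w‖ < 1) :
    A + t * B * z + t * C * w + D * (z * w) ≠ 0 := by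
  rcases le_total ‖B‖ ‖C‖ with h | h
  · exact bilinear_ne_zero_of_norm_le h H ht0 ht1 hz hw
  · have := bilinear_ne_zero_of_norm_le (A := A) (D := D) h
      (fun z w hz hw h0 => H w z hw hz (by linear_combination h0)) ht0 ht1 hw hz
    intro h0
    exact this (by linear_combination h0)

/-! ### Polarization of quadratics -/

open Complex in
/-- The Grace–Walsh–Szegő theorem for quadratic polynomials and the open unit disc. -/
theorem polarized_quadratic_ne_zero {a b c : ℂ}
    (H : ∀ z : ℂ, ‖z‖ < 1 → a + b * z + c * z ^ 2 ≠ 0)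
    {z w : ℂ} (hz : ‖z‖ < 1) (hw : ‖w‖ < 1) :
    a + b * ((z + w) / 2) + c * (z * w) ≠ 0 := by
  intro h0
  by_cases hc : c = 0
  · subst hc
    refine H ((z + w) / 2) ?_ (by linear_combination h0)
    have := norm_add_le z w
    rw [norm_div, RCLike.norm_ofNat]
    linarith
  obtain ⟨s, hs⟩ := IsAlgClosed.exists_pow_nat_eq (b ^ 2 - 4 * a * c) (n := 2) (by norm_num)
  obtain ⟨r₁, hr₁⟩ : ∃ r, r = (-b + s) / (2 * c) := ⟨_, rfl⟩
  obtain ⟨r₂, hr₂⟩ : ∃ r, r = (-b - s) / (2 * c) := ⟨_, rfl⟩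
  have hb : b = -c * (r₁ + r₂) := by rw [hr₁, hr₂]; field_simp; ring
  have ha : a = c * (r₁ * r₂) := by
    rw [hr₁, hr₂]; field_simp; linear_combination hs
  have n1 : 1 ≤ ‖r₁‖ := by
    by_contra! h
    exact H r₁ h (by rw [ha, hb]; ring)
  have n2 : 1 ≤ ‖r₂‖ := by
    by_contra! h
    exact H r₂ h (by rw [ha, hb]; ring)
  have ne : ∀ {z r : ℂ}, ‖z‖ < 1 → 1 ≤ ‖r‖ → z - r ≠ 0 := by
    intro z r hz hr h
    rw [sub_eq_zero.1 h] at hz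
    linarith
  have hz2 := ne hz n2
  have hw2 := ne hw n2
  have hzero : (z - r₁) * (w - r₂) + (z - r₂) * (w - r₁) = 0 := by
    have : c * ((z - r₁) * (w - r₂) + (z - r₂) * (w - r₁)) = 0 := by
      rw [ha, hb] at h0; linear_combination 2 * h0
    exact (mul_eq_zero.1 this).resolve_left hc
  by_cases hr : r₁ = r₂
  · rw [hr] at hzero
    have : (2 : ℂ) * ((z - r₂) * (w - r₂)) = 0 := by linear_combination hzero
    simp [hz2, hw2] at this
  -- The Möbius map `x ↦ (x - r₁) / (x - r₂)` sends `z` and `w` to opposite points `v` and `-v`.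
  -- Pulling the disc condition back gives `|r₁ ∓ r₂ v| < |1 ∓ v|`; the sum of the squares
  -- contradicts `|r₁|, |r₂| ≥ 1`.
  obtain ⟨v, hv⟩ : ∃ v, v = (z - r₁) / (z - r₂) := ⟨_, rfl⟩
  have hv1 : z - r₁ = v * (z - r₂) := by rw [hv]; field_simp
  have hv2 : w - r₁ = -v * (w - r₂) := by
    rw [hv]; field_simp; linear_combination hzero
  have ineq : ∀ z v : ℂ, ‖z‖ < 1 → z - r₁ = v * (z - r₂) →
      normSq (r₁ - r₂ * v) < normSq (1 - v) := by
    intro z v hz hv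
    have h1 : r₁ - r₂ * v = (1 - v) * z := by linear_combination (-1 : ℂ) * hv
    have h2 : 1 - v ≠ 0 := by
      intro h
      apply hr
      linear_combination (-1 : ℂ) * hv + (z - r₂) * h
    have h3 := normSq_pos.2 h2
    have hzsq : normSq z < 1 := by
      rw [normSq_eq_norm_sq]; exact pow_lt_one₀ (norm_nonneg _) hz (by norm_num)
    rw [h1, map_mul]
    nlinarith
  have i1 := ineq z v hz hv1
  have i2 := ineq w (-v) hw hv2
  have m1 : 1 ≤ normSq r₁ := by rw [normSq_eq_norm_sq]; exact one_le_pow₀ n1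
  have m2 : 1 ≤ normSq r₂ := by rw [normSq_eq_norm_sq]; exact one_le_pow₀ n2
  have m3 := mul_nonneg (sub_nonneg.2 m2) (normSq_nonneg v)
  simp only [normSq_apply, mul_re, mul_im, sub_re, sub_im, one_re, one_im, neg_re, neg_im] at *
  nlinarith

/-! ### Ferromagnetic coupling of three-valued spins -/

/-- The multiaffine polynomial in `(z₁, z₂, w₁, w₂)` whose coefficients are those of the
polarization of `∑ c a b z ^ a w ^ b`, damped by a factor `t` for each disagreeing pair of
variables `z`, `w`. -/
noncomputable def dampedPolarization (c : ℕ → ℕ → ℂ) (t₁₁ t₁₂ t₂₁ t₂₂ : ℝ)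
    (z₁ z₂ w₁ w₂ : ℂ) : ℂ :=
  c 0 0 + c 0 1 / 2 * (t₁₁ * t₂₁ * w₁ + t₁₂ * t₂₂ * w₂)
    + c 0 2 * (t₁₁ * t₁₂ * t₂₁ * t₂₂) * (w₁ * w₂)
  + c 1 0 / 2 * (t₁₁ * t₁₂ * z₁ + t₂₁ * t₂₂ * z₂)
    + c 1 1 / 4 * (t₁₂ * t₂₁ * (z₁ * w₁) + t₁₁ * t₂₂ * (z₁ * w₂)
        + t₁₁ * t₂₂ * (z₂ * w₁) + t₁₂ * t₂₁ * (z₂ * w₂))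
    + c 1 2 / 2 * (t₂₁ * t₂₂ * z₁ + t₁₁ * t₁₂ * z₂) * (w₁ * w₂)
  + c 2 0 * (t₁₁ * t₁₂ * t₂₁ * t₂₂) * (z₁ * z₂)
    + c 2 1 / 2 * (z₁ * z₂) * (t₁₂ * t₂₂ * w₁ + t₁₁ * t₂₁ * w₂)
    + c 2 2 * (z₁ * z₂) * (w₁ * w₂)

/-- For fixed `z₂`, `w₂` the polynomial is bilinear in `z₁`, `w₁`, and the pair disagrees exactly in
the two mixed coefficients. The swap symmetries carry this to the other three pairs. -/
theorem dampedPolarization_damp {c : ℕ → ℕ → ℂ} {t₁₂ t₂₁ t₂₂ : ℝ}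
    (H : ∀ z₁ z₂ w₁ w₂ : ℂ, ‖z₁‖ < 1 → ‖z₂‖ < 1 → ‖w₁‖ < 1 → ‖w₂‖ < 1 →
      dampedPolarization c 1 t₁₂ t₂₁ t₂₂ z₁ z₂ w₁ w₂ ≠ 0)
    {t : ℝ} (ht0 : 0 ≤ t) (ht1 : t ≤ 1)
    (z₁ z₂ w₁ w₂ : ℂ) (hz₁ : ‖z₁‖ < 1) (hz₂ : ‖z₂‖ < 1) (hw₁ : ‖w₁‖ < 1) (hw₂ : ‖w₂‖ < 1) :
    dampedPolarization c t t₁₂ t₂₁ t₂₂ z₁ z₂ w₁ w₂ ≠ 0 := by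
  have := bilinear_ne_zero
    (A := c 0 0 + c 0 1 / 2 * (t₁₂ * t₂₂ * w₂) + c 1 0 / 2 * (t₂₁ * t₂₂ * z₂)
      + c 1 1 / 4 * (t₁₂ * t₂₁ * (z₂ * w₂)))
    (B := c 1 0 / 2 * t₁₂ + c 1 1 / 4 * (t₂₂ * w₂)
      + c 2 0 * (t₁₂ * t₂₁ * t₂₂) * z₂ + c 2 1 / 2 * z₂ * (t₂₁ * w₂))
    (C := c 0 1 / 2 * t₂₁ + c 0 2 * (t₁₂ * t₂₁ * t₂₂) * w₂ + c 1 1 / 4 * (t₂₂ * z₂)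
      + c 1 2 / 2 * (t₁₂ * z₂) * w₂)
    (D := c 1 1 / 4 * (t₁₂ * t₂₁) + c 1 2 / 2 * (t₂₁ * t₂₂) * w₂
      + c 2 1 / 2 * z₂ * (t₁₂ * t₂₂) + c 2 2 * z₂ * w₂)
    (fun z w hz hw h0 => H z z₂ w w₂ hz hz₂ hw hw₂ (by
      unfold dampedPolarization; push_cast; linear_combination h0)) ht0 ht1 hz₁ hw₁
  intro h0
  apply this
  unfold dampedPolarization at h0
  linear_combination h0

theorem dampedPolarization_swap_left (c : ℕ → ℕ → ℂ) (t₁₁ t₁₂ t₂₁ t₂₂ : ℝ) (z₁ z₂ w₁ w₂ : ℂ) :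
    dampedPolarization c t₁₁ t₁₂ t₂₁ t₂₂ z₁ z₂ w₁ w₂
      = dampedPolarization c t₂₁ t₂₂ t₁₁ t₁₂ z₂ z₁ w₁ w₂ := by
  unfold dampedPolarization; ring

theorem dampedPolarization_swap_right (c : ℕ → ℕ → ℂ) (t₁₁ t₁₂ t₂₁ t₂₂ : ℝ) (z₁ z₂ w₁ w₂ : ℂ) :
    dampedPolarization c t₁₁ t₁₂ t₂₁ t₂₂ z₁ z₂ w₁ w₂
      = dampedPolarization c t₁₂ t₁₁ t₂₂ t₂₁ z₁ z₂ w₂ w₁ := by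
  unfold dampedPolarization; ring

/-- Ferromagnetic coupling of two spins with values `-1, 0, 1` preserves the absence of zeros in
the open unit bidisc. -/
theorem biquadratic_coupling {c : ℕ → ℕ → ℂ}
    (H : ∀ z w : ℂ, ‖z‖ < 1 → ‖w‖ < 1 →
      ∑ a ∈ Finset.range 3, ∑ b ∈ Finset.range 3, c a b * (z ^ a * w ^ b) ≠ 0)
    {J : ℝ} (hJ : 0 ≤ J) {z w : ℂ} (hz : ‖z‖ < 1) (hw : ‖w‖ < 1) :
    ∑ a ∈ Finset.range 3, ∑ b ∈ Finset.range 3,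
      c a b * Complex.exp (J * ((a : ℂ) - 1) * ((b : ℂ) - 1)) * (z ^ a * w ^ b) ≠ 0 := by
  simp only [Finset.sum_range_succ, Finset.sum_range_zero] at H ⊢
  -- With `a` of the `z`'s and `b` of the `w`'s present, `2 - 2 (a - 1)(b - 1)` of the four pairs
  -- disagree. Hence total damping is `t ^ (2 - 2 (a - 1)(b - 1)) = exp (-J) * exp (J (a - 1)(b -
  -- 1))`: the wanted coupling up to a constant.
  obtain ⟨t, ht⟩ : ∃ t, t = Real.exp (-J / 2) := ⟨_, rfl⟩
  have ht0 : 0 ≤ t := ht ▸ (Real.exp_pos _).le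
  have ht1 : t ≤ 1 := by rw [ht, Real.exp_le_one_iff]; linarith
  have P0 : ∀ z₁ z₂ w₁ w₂ : ℂ, ‖z₁‖ < 1 → ‖z₂‖ < 1 → ‖w₁‖ < 1 → ‖w₂‖ < 1 →
      dampedPolarization c 1 1 1 1 z₁ z₂ w₁ w₂ ≠ 0 := by
    intro z₁ z₂ w₁ w₂ hz₁ hz₂ hw₁ hw₂
    -- Polarize in `z` with `w` fixed, then in `w` with `z₁`, `z₂` fixed.
    have h1 : ∀ w : ℂ, ‖w‖ < 1 → _ := fun w hw => polarized_quadratic_ne_zero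
      (a := c 0 0 + c 0 1 * w + c 0 2 * w ^ 2) (b := c 1 0 + c 1 1 * w + c 1 2 * w ^ 2)
      (c := c 2 0 + c 2 1 * w + c 2 2 * w ^ 2)
      (fun z hz h0 => H z w hz hw (by linear_combination h0)) hz₁ hz₂
    have h2 := polarized_quadratic_ne_zero
      (a := c 0 0 + c 1 0 * ((z₁ + z₂) / 2) + c 2 0 * (z₁ * z₂))
      (b := c 0 1 + c 1 1 * ((z₁ + z₂) / 2) + c 2 1 * (z₁ * z₂))
      (c := c 0 2 + c 1 2 * ((z₁ + z₂) / 2) + c 2 2 * (z₁ * z₂))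
      (fun w hw h0 => h1 w hw (by linear_combination h0)) hw₁ hw₂
    intro h0
    apply h2
    unfold dampedPolarization at h0
    push_cast at h0
    linear_combination h0
  have P1 := dampedPolarization_damp P0 ht0 ht1
  have P2 := dampedPolarization_damp (fun z₁ z₂ w₁ w₂ hz₁ hz₂ hw₁ hw₂ => by
    rw [dampedPolarization_swap_left]; exact P1 z₂ z₁ w₁ w₂ hz₂ hz₁ hw₁ hw₂) ht0 ht1
  have P3 := dampedPolarization_damp (fun z₁ z₂ w₁ w₂ hz₁ hz₂ hw₁ hw₂ => by
    rw [dampedPolarization_swap_right]; exact P2 z₁ z₂ w₂ w₁ hz₁ hz₂ hw₂ hw₁) ht0 ht1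
  have P4 := dampedPolarization_damp (fun z₁ z₂ w₁ w₂ hz₁ hz₂ hw₁ hw₂ => by
    rw [dampedPolarization_swap_left]; exact P3 z₂ z₁ w₁ w₂ hz₂ hz₁ hw₁ hw₂) ht0 ht1
  -- All four pairs are now damped; the diagonal undoes the polarization.
  have h4 := P4 z z w w hz hz hw hw
  have t2 : (t : ℂ) ^ 2 = Complex.exp (-J) := by
    rw [ht, Complex.ofReal_exp, ← Complex.exp_nat_mul]; congr 1; push_cast; ring
  have t2' : Complex.exp J * (t : ℂ) ^ 2 = 1 := by rw [t2, ← Complex.exp_add]; simp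
  intro h0
  apply h4
  unfold dampedPolarization
  norm_num at h0
  rw [← t2] at h0
  linear_combination (t : ℂ) ^ 2 * h0 + (c 0 0 + c 2 2 * (z ^ 2 * w ^ 2)) * (-t2')

/-! ### Couplings in many variables -/

/-- The sum `∑ a, w a * ∏ i, z i ^ m a i` of weighted monomials. -/
noncomputable def monomialSum {ι : Type*} [Fintype ι] {A : Type*} [Fintype A] (w : A → ℂ)
    (m : A → ι → ℕ) (z : ι → ℂ) : ℂ :=
  ∑ a, w a * ∏ i, z i ^ m a i

/-- Freezing all variables but two reduces to the biquadratic case. The factor `f` is kept general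
so that the same coefficients serve without coupling (`f = 1`) and with it. -/
theorem monomialSum_eq_biquadratic {ι : Type*} [Fintype ι] [DecidableEq ι] {A : Type*} [Fintype A]
    (m : A → ι → ℕ) (hm : ∀ a i, m a i < 3) {i j : ι} (hij : i ≠ j) (z : ι → ℂ)
    (w : A → ℂ) (f : ℕ → ℕ → ℂ) (u v : ℂ) :
    monomialSum (fun a => w a * f (m a i) (m a j)) m
        (Function.update (Function.update z i u) j v)
      = ∑ α ∈ Finset.range 3, ∑ β ∈ Finset.range 3,
        (∑ a, if m a i = α ∧ m a j = β then
            w a * ∏ k ∈ (Finset.univ.erase i).erase j, z k ^ m a k else 0)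
          * f α β * (u ^ α * v ^ β) := by
  have hmono : ∀ a, ∏ k, (Function.update (Function.update z i u) j v) k ^ m a k
      = u ^ m a i * v ^ m a j * ∏ k ∈ (Finset.univ.erase i).erase j, z k ^ m a k := by
    intro a
    rw [← Finset.mul_prod_erase _ _ (Finset.mem_univ i),
      ← Finset.mul_prod_erase (Finset.univ.erase i) _
        (Finset.mem_erase.2 ⟨hij.symm, Finset.mem_univ j⟩), mul_assoc]
    simp only [Function.update_self, Function.update_of_ne hij]
    congr 2
    refine Finset.prod_congr rfl fun k hk => ?_
    simp only [Finset.mem_erase] at hk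
    rw [Function.update_of_ne hk.1, Function.update_of_ne hk.2.1]
  unfold monomialSum
  simp only [hmono, Finset.sum_mul]
  simp only [Finset.sum_comm (s := Finset.range 3) (t := Finset.univ)]
  refine Finset.sum_congr rfl fun a _ => ?_
  simp only [ite_mul, zero_mul, ite_and]
  rw [Finset.sum_eq_single_of_mem (m a i) (Finset.mem_range.2 (hm a i))]
  · simp only [if_true, Finset.sum_ite_eq, Finset.mem_range, hm]
    ring
  · intro b _ hb
    simp [hb.symm]

/-- Ferromagnetic coupling of two spins with values `m - 1 ∈ {-1, 0, 1}` preserves the absence of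
zeros in the open unit polydisc. -/
theorem monomialSum_coupling {ι : Type*} [Fintype ι] [DecidableEq ι] {A : Type*} [Fintype A]
    {w : A → ℂ} {m : A → ι → ℕ} (hm : ∀ a i, m a i < 3)
    (H : ∀ z : ι → ℂ, (∀ i, ‖z i‖ < 1) → monomialSum w m z ≠ 0)
    {i j : ι} (hij : i ≠ j) {J : ℝ} (hJ : 0 ≤ J) (z : ι → ℂ) (hz : ∀ i, ‖z i‖ < 1) :
    monomialSum (fun a => w a * Complex.exp (J * ((m a i : ℂ) - 1) * ((m a j : ℂ) - 1))) m z
      ≠ 0 := by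
  have e := monomialSum_eq_biquadratic m hm hij z w
  have e1 := e (fun a b => Complex.exp (J * ((a : ℂ) - 1) * ((b : ℂ) - 1))) (z i) (z j)
  rw [Function.update_eq_self, Function.update_eq_self] at e1
  rw [e1]
  refine biquadratic_coupling (fun u v hu hv => ?_) hJ (hz i) (hz j)
  have e2 := e (fun _ _ => 1) u v
  simp only [mul_one] at e2
  rw [← e2]
  refine H _ fun k => ?_
  by_cases hkj : k = j
  · subst hkj; simpa using hv
  · rw [Function.update_of_ne hkj]
    by_cases hki : k = i
    · subst hki; simpa using hu
    · rw [Function.update_of_ne hki]; exact hz k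

theorem monomialSum_couplings {ι : Type*} [Fintype ι] [DecidableEq ι] {A : Type*} [Fintype A]
    {w : A → ℂ} {m : A → ι → ℕ} (hm : ∀ a i, m a i < 3)
    (H : ∀ z : ι → ℂ, (∀ i, ‖z i‖ < 1) → monomialSum w m z ≠ 0)
    {L : ι × ι → ℝ} (hL : ∀ p, 0 ≤ L p) (hdiag : ∀ i, L (i, i) = 0) (S : Finset (ι × ι))
    (z : ι → ℂ) (hz : ∀ i, ‖z i‖ < 1) :
    monomialSum (fun a => w a *
      Complex.exp (∑ p ∈ S, L p * ((m a p.1 : ℂ) - 1) * ((m a p.2 : ℂ) - 1))) m z ≠ 0 := by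
  induction S using Finset.induction_on generalizing z with
  | empty => simpa using H z hz
  | insert p S hp ih =>
    obtain ⟨i, j⟩ := p
    simp only [Finset.sum_insert hp]
    by_cases hij : i = j
    · subst hij
      simpa [hdiag] using ih z hz
    · have := monomialSum_coupling hm ih hij (hL (i, j)) z hz
      simpa only [mul_assoc, ← Complex.exp_add, add_comm] using this

/-! ### Schur–Cohn and the pair polynomial -/

open Complex in
/-- The Schur–Cohn criterion for quadratic polynomials. -/
theorem quadratic_ne_zero_of_schur {A B D z : ℂ} (hD : ‖D‖ < ‖A‖)
    (hS : 2 * ‖A * (starRingEnd ℂ) B - B * (starRingEnd ℂ) D‖ ≤ normSq A - normSq D)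
    (hz : ‖z‖ < 1) : A + 2 * B * z + D * z ^ 2 ≠ 0 := by
  intro h0
  have hA : 0 < ‖A‖ := (norm_nonneg D).trans_lt hD
  have hB : 2 * ‖B‖ ≤ ‖A‖ + ‖D‖ := by
    have h1 := norm_sub_norm_le (A * (starRingEnd ℂ) B) (B * (starRingEnd ℂ) D)
    rw [norm_mul, norm_mul, norm_conj, norm_conj] at h1
    rw [normSq_eq_norm_sq, normSq_eq_norm_sq] at hS
    have : (2 * ‖B‖) * (‖A‖ - ‖D‖) ≤ (‖A‖ + ‖D‖) * (‖A‖ - ‖D‖) := by linarith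
    exact le_of_mul_le_mul_right this (by linarith)
  have h1 : A + B * z = -(z * (B + D * z)) := by linear_combination h0
  have h2 : normSq (A + B * z) ≤ normSq (B + D * z) := by
    rw [h1, normSq_neg, map_mul, normSq_eq_norm_sq z]
    exact mul_le_of_le_one_left (normSq_nonneg _) (pow_le_one₀ (norm_nonneg _) hz.le)
  have id : normSq (A + B * z) - normSq (B + D * z)
      = normSq A - normSq B + (normSq B - normSq D) * normSq z
        + 2 * ((A * (starRingEnd ℂ) B - B * (starRingEnd ℂ) D) * (starRingEnd ℂ) z).re := by
    simp only [normSq_apply, mul_re, mul_im, add_re, add_im, sub_re, sub_im, conj_re, conj_im]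
    ring
  have h3 := neg_le_of_abs_le (abs_re_le_norm
    ((A * (starRingEnd ℂ) B - B * (starRingEnd ℂ) D) * (starRingEnd ℂ) z))
  rw [norm_mul, norm_conj] at h3
  simp only [normSq_eq_norm_sq] at *
  set a := ‖A‖
  set b := ‖B‖
  set d := ‖D‖
  set ρ := ‖z‖
  have hρ : 0 ≤ ρ := norm_nonneg z
  have hb : 0 ≤ b := norm_nonneg B
  have hd : 0 ≤ d := norm_nonneg D
  have h4 := mul_le_mul_of_nonneg_right hS hρ
  -- The second factor is affine in `ρ`, positive at `0` and nonnegative at `1` because `2 b ≤ a +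
  -- d`; so it is positive for `ρ < 1`.
  have h5 : (1 - ρ) * (a ^ 2 - b ^ 2 + ρ * (d ^ 2 - b ^ 2)) ≤ 0 := by nlinarith
  have h6 : 0 < a ^ 2 - b ^ 2 := by nlinarith
  have h7 : 0 ≤ a ^ 2 + d ^ 2 - 2 * b ^ 2 := by nlinarith [sq_nonneg (a - d)]
  have h8 : 0 < a ^ 2 - b ^ 2 + ρ * (d ^ 2 - b ^ 2) := by nlinarith
  nlinarith

/-- Replacing `s²` by its upper bound `a² - t²` leaves a quadratic `F t` to be bounded below on
`[-a, a]`. Here `F (-a)` is the quantity in `h0`, and `F t - F (-a)` is `t + a` times an affine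
function, checked at its endpoints in `h1` and `h2`. -/
theorem schur_inequality {C r a t s : ℝ} (hC : 1 ≤ C) (hr : 0 ≤ r) (hrC : r ^ 2 ≤ C)
    (ha : 0 ≤ a) (hts : t ^ 2 + s ^ 2 ≤ a ^ 2) :
    r ^ 2 * ((C + 1) * (a + r * t) ^ 2 + (C - 1) * (r * s) ^ 2) ≤ (C + 1) * (C * a + r * t) ^ 2 := by
  have hs : 0 ≤ (r ^ 2) ^ 2 * (C - 1) * (a ^ 2 - t ^ 2 - s ^ 2) :=
    mul_nonneg (mul_nonneg (by positivity) (by linarith)) (by linarith)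
  have ht : |t| ≤ a := abs_le_of_sq_le_sq (by nlinarith [sq_nonneg s]) ha
  obtain ⟨ht1, ht2⟩ := abs_le.1 ht
  have hrC' : r ≤ C := by nlinarith
  have h0 : 0 ≤ (C + 1) * a ^ 2 * ((C - 2 * r + r ^ 2) * (C - r ^ 2)) := by
    have : 0 ≤ C - 2 * r + r ^ 2 := by nlinarith [sq_nonneg (r - 1)]
    have := mul_nonneg this (sub_nonneg.2 hrC)
    positivity
  have h1 : 0 ≤ 2 * r * (C + 1) * (C - r ^ 2) :=
    mul_nonneg (by positivity) (by linarith)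
  have h2 : 0 ≤ 2 * r * ((C + 1) * (C - r ^ 2) - r * (C + 1 - 2 * r ^ 2)) := by
    refine mul_nonneg (by positivity) ?_
    rcases le_total r 1 with h | h
    · nlinarith [mul_nonneg (sub_nonneg.2 h) (sub_nonneg.2 (pow_le_one₀ (n := 2) hr h)),
        sq_nonneg (C - 1), mul_nonneg (sub_nonneg.2 hC)
          (by nlinarith : 0 ≤ 3 - r ^ 2 - r)]
    · nlinarith [sq_nonneg (C - r ^ 2), mul_nonneg (sub_nonneg.2 hrC)
        (by nlinarith : 0 ≤ 1 + r ^ 2 - r), mul_nonneg hr (by nlinarith : 0 ≤ r ^ 2 - 1)]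
  have h3 : 0 ≤ (t + a) * ((a + t) * (2 * r * (C + 1) * (C - r ^ 2))
      + (a - t) * (2 * r * ((C + 1) * (C - r ^ 2) - r * (C + 1 - 2 * r ^ 2)))) := by
    have := mul_nonneg (by linarith : 0 ≤ a + t) h1
    have := mul_nonneg (by linarith : 0 ≤ a - t) h2
    exact mul_nonneg (by linarith) (by linarith)
  nlinarith

open Complex in
/-- The polynomial of two spins with values `-1, 0, 1` coupled with `cosh K = C`, `sinh K = S` has
no zeros in the open unit bidisc. -/
theorem pair_polynomial_ne_zero {C S r : ℝ} (hS : 0 < S) (hC : 1 ≤ C) (hCS : S ^ 2 = C ^ 2 - 1)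
    (hr : 0 ≤ r) (hrC : r ^ 2 ≤ C) {z w : ℂ} (hz : ‖z‖ < 1) (hw : ‖w‖ < 1) :
    ((C + S : ℝ) : ℂ) * (z ^ 2 * w ^ 2 + 1) + ((C - S : ℝ) : ℂ) * (z ^ 2 + w ^ 2)
      + 2 * r * ((z ^ 2 + 1) * w + z * (w ^ 2 + 1)) + 4 * r ^ 2 * (z * w) ≠ 0 := by
  -- Coefficients of the polynomial as a quadratic `A + 2 B z + D z ^ 2` in `z`.
  obtain ⟨A, hA⟩ : ∃ A : ℂ, A = ((C + S : ℝ) : ℂ) + 2 * r * w + ((C - S : ℝ) : ℂ) * w ^ 2 :=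
    ⟨_, rfl⟩
  obtain ⟨B, hB⟩ : ∃ B : ℂ, B = r * (1 + 2 * r * w + w ^ 2) := ⟨_, rfl⟩
  obtain ⟨D, hD⟩ : ∃ D : ℂ, D = ((C - S : ℝ) : ℂ) + 2 * r * w + ((C + S : ℝ) : ℂ) * w ^ 2 :=
    ⟨_, rfl⟩
  have hn : normSq w < 1 := by
    rw [normSq_eq_norm_sq]; exact pow_lt_one₀ (norm_nonneg _) hw (by norm_num)
  have hn0 := normSq_nonneg w
  have hnw : normSq w = w.re ^ 2 + w.im ^ 2 := by rw [normSq_apply]; ring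
  have hAD : normSq A - normSq D
      = 4 * S * (1 - normSq w) * (C * (1 + normSq w) + r * (2 * w.re)) := by
    rw [hA, hD]
    simp only [normSq_apply, mul_re, mul_im, add_re, add_im, ofReal_re, ofReal_im, pow_two, re_ofNat, im_ofNat]
    ring
  have hX : normSq (A * (starRingEnd ℂ) B - B * (starRingEnd ℂ) D)
      = 4 * (1 - normSq w) ^ 2 * (r ^ 2 * (S ^ 2 * (1 + normSq w + r * (2 * w.re)) ^ 2
        + (C - 1) ^ 2 * (r * (2 * w.im)) ^ 2)) := by
    have : A * (starRingEnd ℂ) B - B * (starRingEnd ℂ) D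
        = ((2 * r * (1 - normSq w) * (S * (1 + normSq w + r * (2 * w.re))) : ℝ) : ℂ)
          + ((2 * r * (1 - normSq w) * ((1 - C) * (r * (2 * w.im))) : ℝ) : ℂ) * I := by
      rw [hA, hB, hD]
      apply Complex.ext <;>
      · simp only [normSq_apply, mul_re, mul_im, add_re, add_im, sub_re, sub_im, conj_re, conj_im,
          ofReal_re, ofReal_im, pow_two, re_ofNat, im_ofNat, one_re, one_im, I_re, I_im]
        ring
    rw [this, normSq_add_mul_I]
    ring
  have hpos : 0 < C * (1 + normSq w) + r * (2 * w.re) := by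
    have h1 : r ≤ C := by nlinarith
    have h2 : -1 < w.re := by
      have := neg_le_of_abs_le (abs_re_le_norm w); linarith
    nlinarith [sq_nonneg (w.re + 1), sq_nonneg w.im]
  have hADpos : 0 < normSq A - normSq D := by
    rw [hAD]; exact mul_pos (mul_pos (by linarith) (by linarith)) hpos
  have key := schur_inequality hC hr hrC (a := 1 + normSq w) (t := 2 * w.re) (s := 2 * w.im)
    (by linarith) (by nlinarith [sq_nonneg (1 - normSq w)])
  have h0 := quadratic_ne_zero_of_schur (A := A) (B := B) (D := D) (z := z) ?_ ?_ hz
  · intro h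
    apply h0
    rw [hA, hB, hD]
    linear_combination h
  · rw [normSq_eq_norm_sq, normSq_eq_norm_sq, sub_pos] at hADpos
    exact lt_of_pow_lt_pow_left₀ 2 (norm_nonneg _) hADpos
  · rw [normSq_eq_norm_sq] at hX
    refine (sq_le_sq₀ (by positivity) hADpos.le).1 ?_
    rw [mul_pow, hX, hAD]
    -- Since `S² = (C - 1)(C + 1)`, the squared Schur condition is `schur_inequality` times `16 (1 -
    -- |w|²)² (C - 1)`.
    have h1 := mul_le_mul_of_nonneg_left key
      (by have := sub_nonneg.2 hC; positivity : 0 ≤ 16 * (1 - normSq w) ^ 2 * (C - 1))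
    rw [show (4 * S * (1 - normSq w) * (C * (1 + normSq w) + r * (2 * w.re))) ^ 2
      = 16 * (1 - normSq w) ^ 2 * S ^ 2 * (C * (1 + normSq w) + r * (2 * w.re)) ^ 2 by ring, hCS]
    linear_combination h1

/-! ### Factorization over pairs -/

/-- The exponent `spin + 1 ∈ {0, 1, 2}` of a site of a diluted `±1` spin configuration. -/
def siteExponent {ι : Type*} (a : (ι → Bool) × (ι → Bool)) (i : ι) : ℕ :=
  if a.1 i then (if a.2 i then 2 else 0) else 1

theorem siteExponent_lt {ι : Type*} (a : (ι → Bool) × (ι → Bool)) (i : ι) :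
    siteExponent a i < 3 := by
  unfold siteExponent; split_ifs <;> norm_num

theorem cast_siteExponent_sub_one {ι : Type*} (a : (ι → Bool) × (ι → Bool)) (i : ι) :
    (siteExponent a i : ℂ) - 1 = if a.1 i then (if a.2 i then 1 else -1) else 0 := by
  unfold siteExponent; split_ifs <;> norm_num

/-- Configurations on paired sites, as families of configurations of the pairs. -/
def pairConfigEquiv {κ ι : Type*} (e : κ × Bool ≃ ι) :
    (κ → (Bool → Bool) × (Bool → Bool)) ≃ (ι → Bool) × (ι → Bool) :=
  (Equiv.arrowProdEquivProdArrow κ (fun _ => Bool → Bool) (fun _ => Bool → Bool)).trans <|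
    Equiv.prodCongr
      ((Equiv.curry κ Bool Bool).symm.trans (Equiv.arrowCongr e (Equiv.refl Bool)))
      ((Equiv.curry κ Bool Bool).symm.trans (Equiv.arrowCongr e (Equiv.refl Bool)))

theorem pairConfigEquiv_fst {κ ι : Type*} (e : κ × Bool ≃ ι)
    (t : κ → (Bool → Bool) × (Bool → Bool)) (k : κ) (b : Bool) :
    (pairConfigEquiv e t).1 (e (k, b)) = (t k).1 b := by
  simp [pairConfigEquiv, Equiv.arrowProdEquivProdArrow]

theorem siteExponent_pairConfigEquiv {κ ι : Type*} (e : κ × Bool ≃ ι)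
    (t : κ → (Bool → Bool) × (Bool → Bool)) (k : κ) (b : Bool) :
    siteExponent (pairConfigEquiv e t) (e (k, b)) = siteExponent (t k) b := by
  simp [siteExponent, pairConfigEquiv, Equiv.arrowProdEquivProdArrow]

theorem monomialSum_pairs {κ ι : Type*} [Fintype κ] [DecidableEq κ] [Fintype ι] [DecidableEq ι]
    (e : κ × Bool ≃ ι) (q K : ℝ) (z : ι → ℂ) :
    monomialSum (fun a : (ι → Bool) × (ι → Bool) => (thinningWeight q a.1 : ℂ)
        * Complex.exp (∑ k, K * ((siteExponent a (e (k, true)) : ℂ) - 1)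
          * ((siteExponent a (e (k, false)) : ℂ) - 1))) siteExponent z
      = ∏ k, monomialSum (fun a : (Bool → Bool) × (Bool → Bool) => (thinningWeight q a.1 : ℂ)
        * Complex.exp (K * ((siteExponent a true : ℂ) - 1) * ((siteExponent a false : ℂ) - 1)))
          siteExponent (fun b => z (e (k, b))) := by
  unfold monomialSum
  rw [Finset.prod_univ_sum, Fintype.piFinset_univ]
  refine (Fintype.sum_equiv (pairConfigEquiv e) _ _ fun t => ?_).symm
  simp only [siteExponent_pairConfigEquiv, thinningWeight, Complex.exp_sum, Complex.ofReal_prod]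
  rw [← e.prod_comp, ← e.prod_comp, Fintype.prod_prod_type, Fintype.prod_prod_type]
  simp only [siteExponent_pairConfigEquiv, pairConfigEquiv_fst, Finset.prod_mul_distrib]

/-- A deleted site still carries an idle sign, which is summed over; hence it contributes `2 q z`
against `(1 - q)(z ^ 2 + 1)` for a kept one. -/
theorem monomialSum_pair (q K : ℝ) (z : Bool → ℂ) :
    monomialSum (fun a : (Bool → Bool) × (Bool → Bool) => (thinningWeight q a.1 : ℂ)
        * Complex.exp (K * ((siteExponent a true : ℂ) - 1) * ((siteExponent a false : ℂ) - 1)))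
          siteExponent z
      = (1 - q) ^ 2 * (Complex.exp K * (z true ^ 2 * z false ^ 2 + 1)
          + Complex.exp (-K) * (z true ^ 2 + z false ^ 2))
        + 2 * ((1 - q) * q) * ((z true ^ 2 + 1) * z false + z true * (z false ^ 2 + 1))
        + 4 * q ^ 2 * (z true * z false) := by
  unfold monomialSum
  rw [Fintype.sum_prod_type]
  simp only [← (Equiv.boolArrowEquivProd Bool).symm.sum_comp, Fintype.sum_prod_type]
  simp [thinningWeight, siteExponent]
  ring_nf

/-! ### The partition function as a spin sum -/

theorem annealedZ_eq {ι : Type*} [Fintype ι] [DecidableEq ι] (J : Matrix ι ι ℝ) (β q : ℝ)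
    (h : ℂ) :
    annealedZ J β q h = ∑ a : (ι → Bool) × (ι → Bool), (thinningWeight q a.1 : ℂ)
      * Complex.exp (halfQuadForm (β • J) (fun i => (siteExponent a i : ℂ) - 1))
      * Complex.exp (∑ i, ((siteExponent a i : ℂ) - 1) * (β * h)) := by
  unfold annealedZ expQuadOp
  rw [averagedProduct_eq, (hasSum_expSum _ _ _ _).tsum_eq, Finset.mul_sum]
  refine Finset.sum_congr rfl fun a _ => ?_
  simp only [cast_siteExponent_sub_one]
  have : (2 : ℂ) ^ Fintype.card ι * (1 / 2) ^ Fintype.card ι = 1 := by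
    rw [← mul_pow]; norm_num
  linear_combination (thinningWeight q a.1 : ℂ)
      * Complex.exp (halfQuadForm (β • J)
        (fun i => if a.1 i then (if a.2 i then (1 : ℂ) else -1) else 0))
      * Complex.exp (∑ i, (if a.1 i then (if a.2 i then (1 : ℂ) else -1) else 0) * (β * h)) * this

theorem annealedZ_eq_monomialSum {ι : Type*} [Fintype ι] [DecidableEq ι] (J : Matrix ι ι ℝ)
    (β q : ℝ) (h : ℂ) :
    annealedZ J β q h = Complex.exp (-(β * h)) ^ Fintype.card ι
      * monomialSum (fun a : (ι → Bool) × (ι → Bool) => (thinningWeight q a.1 : ℂ)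
        * Complex.exp (halfQuadForm (β • J) (fun i => (siteExponent a i : ℂ) - 1)))
        siteExponent (fun _ => Complex.exp (β * h)) := by
  rw [annealedZ_eq, monomialSum, Finset.mul_sum]
  refine Finset.sum_congr rfl fun a _ => ?_
  rw [Complex.exp_sum, mul_left_comm]
  congr 1
  rw [← Finset.card_univ, ← Finset.prod_const, ← Finset.prod_mul_distrib]
  refine Finset.prod_congr rfl fun i _ => ?_
  rw [← Complex.exp_nat_mul, ← Complex.exp_add]
  congr 1; ring

theorem annealedZ_neg {ι : Type*} [Fintype ι] [DecidableEq ι] (J : Matrix ι ι ℝ) (β q : ℝ)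
    (h : ℂ) : annealedZ J β q (-h) = annealedZ J β q h := by
  rw [annealedZ_eq, annealedZ_eq]
  -- Global spin flip, leaving the dilution unchanged.
  refine Fintype.sum_equiv (Equiv.prodCongr (Equiv.refl _)
    (Equiv.arrowCongr (Equiv.refl ι) Equiv.boolNot)) _ _ fun a => ?_
  have e : ∀ i, (siteExponent ((Equiv.prodCongr (Equiv.refl (ι → Bool))
      (Equiv.arrowCongr (Equiv.refl ι) Equiv.boolNot)) a) i : ℂ) - 1
        = -((siteExponent a i : ℂ) - 1) := by
    intro i
    rw [cast_siteExponent_sub_one, cast_siteExponent_sub_one]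
    cases h1 : a.1 i <;> cases h2 : a.2 i <;> simp [h1, h2]
  simp only [e, halfQuadForm, mul_neg, neg_mul, neg_neg]
  rfl

theorem annealedZ_zero_ne_zero {ι : Type*} [Fintype ι] [DecidableEq ι] (J : Matrix ι ι ℝ)
    {β q : ℝ} (hq0 : 0 ≤ q) (hq1 : q < 1) : annealedZ J β q 0 ≠ 0 := by
  obtain ⟨x, hx⟩ : ∃ x : ℝ, x = ∑ a : (ι → Bool) × (ι → Bool), thinningWeight q a.1
      * Real.exp ((1 / 2) * ∑ i, ∑ j, (β • J) i j * ((siteExponent a i : ℝ) - 1)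
        * ((siteExponent a j : ℝ) - 1)) := ⟨_, rfl⟩
  have hZ : annealedZ J β q 0 = x := by
    rw [annealedZ_eq, hx]
    push_cast
    simp [halfQuadForm]
  have hw : ∀ η : ι → Bool, 0 ≤ thinningWeight q η := fun η =>
    Finset.prod_nonneg fun i _ => by split_ifs <;> linarith
  have hpos : 0 < x := by
    rw [hx]
    refine Finset.sum_pos' (fun a _ => mul_nonneg (hw _) (Real.exp_pos _).le)
      ⟨(fun _ => true, fun _ => true), Finset.mem_univ _, mul_pos ?_ (Real.exp_pos _)⟩
    exact Finset.prod_pos fun i _ => by simpa using hq1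
  rw [hZ]
  exact_mod_cast hpos.ne'

/-! ### Splitting off the pair couplings -/

/-- The site paired with `i`. -/
def partner {κ ι : Type*} (e : κ × Bool ≃ ι) (i : ι) : ι :=
  e ((e.symm i).1, !(e.symm i).2)

theorem partner_ne {κ ι : Type*} (e : κ × Bool ≃ ι) (i : ι) : partner e i ≠ i := by
  intro h
  have := congrArg (fun i => (e.symm i).2) h
  simp [partner] at this

/-- Each pair occurs in both orders, so `K / 2` is subtracted per ordered pair. -/
theorem halfQuadForm_eq_pairs_add {κ ι : Type*} [Fintype κ] [Fintype ι] [DecidableEq ι]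
    (e : κ × Bool ≃ ι) (M : Matrix ι ι ℝ) (K : ℝ) (v : ι → ℂ) :
    halfQuadForm M v = ∑ k, K * v (e (k, true)) * v (e (k, false))
      + ∑ p : ι × ι, ((M p.1 p.2 / 2 - if p.2 = partner e p.1 then K / 2 else 0 : ℝ) : ℂ)
        * v p.1 * v p.2 := by
  have h1 : ∑ i, ∑ j, (if j = partner e i then (K / 2 : ℂ) * v i * v j else 0)
      = ∑ k, K * v (e (k, true)) * v (e (k, false)) := by
    simp only [Finset.sum_ite_eq', Finset.mem_univ, if_true]
    rw [← e.sum_comp, Fintype.sum_prod_type]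
    refine Finset.sum_congr rfl fun k _ => ?_
    simp [partner]
    ring
  rw [← h1, Fintype.sum_prod_type, halfQuadForm, Finset.mul_sum, ← Finset.sum_add_distrib]
  refine Finset.sum_congr rfl fun i _ => ?_
  rw [Finset.mul_sum, ← Finset.sum_add_distrib]
  refine Finset.sum_congr rfl fun j _ => ?_
  split_ifs <;> push_cast <;> ring

theorem ConditionI.exists_equiv {N : ℕ} {J : Matrix (Fin (2 * N)) (Fin (2 * N)) ℝ} {ϰ : ℝ}
    (hJ : ConditionI J ϰ) :
    ∃ e : Fin N × Bool ≃ Fin (2 * N), ∀ i, ϰ ≤ J i (partner e i) := by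
  obtain ⟨ϑ, hdisj, -, hpair⟩ := hJ.division
  choose i j hij hϑ hle using hpair
  have hmem : ∀ (k : Fin N) (b : Bool), (if b then i k else j k) ∈ ϑ k := by
    intro k b; rw [hϑ]; cases b <;> simp
  have hinj : Function.Injective (fun p : Fin N × Bool => if p.2 then i p.1 else j p.1) := by
    rintro ⟨k, b⟩ ⟨l, c⟩ h
    have hkl : k = l := by
      by_contra hne
      refine Finset.disjoint_left.1 (hdisj k l hne) (hmem k b) ?_
      have := hmem l c
      simp only at h
      rwa [← h] at this
    subst hkl
    have h1 := hij k
    cases b <;> cases c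
    · rfl
    · exact absurd h.symm (by simpa using h1)
    · exact absurd h (by simpa using h1)
    · rfl
  have hbij := (Fintype.bijective_iff_injective_and_card _).2
    ⟨hinj, by simp [mul_comm]⟩
  refine ⟨Equiv.ofBijective _ hbij, fun x => ?_⟩
  obtain ⟨⟨k, b⟩, rfl⟩ := (Equiv.ofBijective _ hbij).surjective x
  simp only [partner, Equiv.symm_apply_apply]
  cases b
  · simpa [hJ.symm (j k)] using hle k
  · simpa using hle k

/-! ### Location of the zeros -/

theorem ConditionI.hasPurelyImaginaryZeros {N : ℕ} {J : Matrix (Fin (2 * N)) (Fin (2 * N)) ℝ}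
    {ϰ : ℝ} (hJ : ConditionI J ϰ) {β q : ℝ} (hβ : 0 < β) (hq0 : 0 ≤ q) (hq1 : q < 1)
    (hq : (q / (1 - q)) ^ 2 ≤ Real.cosh (β * ϰ)) :
    HasPurelyImaginaryZeros (annealedZ J β q) := by
  obtain ⟨e, he⟩ := hJ.exists_equiv
  have hp : 0 < 1 - q := by linarith
  have hK : 0 < β * ϰ := mul_pos hβ hJ.pos
  have hbase : ∀ z : Fin (2 * N) → ℂ, (∀ i, ‖z i‖ < 1) →
      monomialSum (fun a : (Fin (2 * N) → Bool) × (Fin (2 * N) → Bool) =>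
        (thinningWeight q a.1 : ℂ)
        * Complex.exp (∑ k, ((β * ϰ : ℝ) : ℂ) * ((siteExponent a (e (k, true)) : ℂ) - 1)
          * ((siteExponent a (e (k, false)) : ℂ) - 1))) siteExponent z ≠ 0 := by
    intro z hz
    rw [monomialSum_pairs e, Finset.prod_ne_zero_iff]
    intro k _
    rw [monomialSum_pair]
    have := pair_polynomial_ne_zero (Real.sinh_pos_iff.2 hK) (Real.one_le_cosh (β * ϰ))
      (by linarith [Real.cosh_sq (β * ϰ)]) (div_nonneg hq0 hp.le) hq
      (hz (e (k, true))) (hz (e (k, false)))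
    rw [Real.cosh_add_sinh, Real.cosh_sub_sinh] at this
    have hp' : (1 - q : ℂ) ≠ 0 := by exact_mod_cast hp.ne'
    intro h0
    apply mul_ne_zero (pow_ne_zero 2 hp') this
    push_cast at h0 ⊢
    field_simp
    linear_combination h0
  have hleft : ∀ h : ℂ, h.re < 0 → annealedZ J β q h ≠ 0 := by
    intro h hh
    rw [annealedZ_eq_monomialSum]
    refine mul_ne_zero (pow_ne_zero _ (Complex.exp_ne_zero _)) ?_
    have := monomialSum_couplings siteExponent_lt hbase
      (L := fun p => (β • J) p.1 p.2 / 2 - if p.2 = partner e p.1 then β * ϰ / 2 else 0)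
      (fun p => ?_) (fun i => ?_) Finset.univ (fun _ => Complex.exp (β * h)) (fun _ => ?_)
    · simpa only [mul_assoc (Complex.ofReal _), mul_assoc (Complex.ofReal _ * Complex.exp _),
        halfQuadForm_eq_pairs_add e (β • J) (β * ϰ), Complex.exp_add] using this
    · simp only [Matrix.smul_apply, smul_eq_mul]
      split_ifs with h1
      · rw [h1]
        have := mul_le_mul_of_nonneg_left (he p.1) hβ.le
        linarith
      · have := mul_nonneg hβ.le (hJ.nonneg p.1 p.2)
        linarith
    · simp [hJ.diag, (partner_ne e i).symm]
    · rw [Complex.norm_exp, Real.exp_lt_one_iff]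
      simpa using mul_neg_of_pos_of_neg hβ hh
  intro h h0
  have hre : h.re = 0 := by
    rcases lt_trichotomy h.re 0 with hlt | heq | hgt
    · exact absurd h0 (hleft h hlt)
    · exact heq
    · refine absurd ?_ (hleft (-h) (by simpa using hgt))
      rwa [annealedZ_neg]
  refine ⟨hre, fun him => annealedZ_zero_ne_zero J hq0 hq1 (β := β) ?_⟩
  rwa [show h = 0 from Complex.ext hre him] at h0

theorem corollary2 :
    (∀ (N : ℕ) (J : Matrix (Fin (2 * N)) (Fin (2 * N)) ℝ) (ϰ : ℝ), ConditionI J ϰ →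
      ∀ β q : ℝ, 0 < β → 0 ≤ q → q < 1 →
        q / (1 - q) ≤ Real.sqrt ((Real.exp (β * ϰ) + Real.exp (-(β * ϰ))) / 2) →
        HasPurelyImaginaryZeros (annealedZ J β q)) ∧
    (∀ ϰ q : ℝ, 0 < ϰ → 0 ≤ q → q < 1 →
      ∃ β₀ : ℝ, 0 < β₀ ∧ ∀ β : ℝ, β₀ ≤ β →
        ∀ (N : ℕ) (J : Matrix (Fin (2 * N)) (Fin (2 * N)) ℝ), ConditionI J ϰ →
          HasPurelyImaginaryZeros (annealedZ J β q)) := by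
  refine ⟨fun N J ϰ hJ β q hβ hq0 hq1 hq => ?_, fun ϰ q hϰ hq0 hq1 => ?_⟩
  · rw [← Real.cosh_eq] at hq
    refine hJ.hasPurelyImaginaryZeros hβ hq0 hq1 ?_
    exact (Real.le_sqrt (div_nonneg hq0 (by linarith)) (Real.cosh_pos _).le).1 hq
  -- Chosen via `cosh x ≥ exp x / 2 ≥ (x + 1) / 2`; the `+ 1` keeps the threshold positive at `q =
  -- 0`.
  · refine ⟨(2 * (q / (1 - q)) ^ 2 + 1) / ϰ, by positivity, fun β hβ N J hJ => ?_⟩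
    have hβ0 : 0 < β := lt_of_lt_of_le (by positivity) hβ
    refine hJ.hasPurelyImaginaryZeros hβ0 hq0 hq1 ?_
    rw [div_le_iff₀ hϰ] at hβ
    rw [Real.cosh_eq]
    linarith [Real.add_one_le_exp (β * ϰ), Real.exp_pos (-(β * ϰ))]
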